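/- Let $L\ge 1$, and let $(p_j)$ be fixed positive numbers indexed by the $2^L$ binary words $j$ of length $L$ (the prefixes). Consider samples of $n\to\infty$ pairs (prefix, suffix), the prefix a binary word of length $L$ and the suffix an element of $\{0,1\}$ (the next increase indicator), such that, given all the prefixes, the suffixes are independent and, after the prefix $j$, Bernoulli with parameter $\pi_j$; the joint law of the prefixes is arbitrary. Assume the efficient-market null $\pi_j=1/2$ for all $j$. Let $n_j$ be the number of observations with prefix $j$, $\hat p_j=n_j/n$, let $\hat\pi_j$ be the proportion of suffixes equal to $1$ among these $n_j$ observations, and (with $0\log_2 0=0$) $$\hat I^{L+1}=-\sum_j \hat p_j\log_2\frac{\hat p_j}{2}+\sum_j\Big(\hat p_j\hat\pi_j\log_2(\hat p_j\hat\pi_j)+\hat p_j(1-\hat\pi_j)\log_2(\hat p_j(1-\hat\pi_j))\Big).$$ Let $n$ tend to infinity along sample sizes for which the event $\mathcal E=\{\hat p_j=p_j\ \forall j\}$ has positive probability, and let $\varphi_n(t)=\mathbb E[e^{it\hat I^{L+1}}\mid\mathcal E]$. Put $$g_j(t,x)=\exp\Big(it\big[p_jx\log_2(p_jx)+p_j(1-x)\log_2(p_j(1-x))-p_j\log_2(p_j/2)\big]\Big).$$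 Then: 1. $\varphi_n(t)=\prod_j\mathbb E[g_j(t,\hat\pi_j)\mid\mathcal E]$ for all $t\in\mathbb R$ and all such $n$. 2. For every fixed $t\in\mathbb R$, as $n\to\infty$, $$\varphi_n(t)\sim\prod_j\Big(1+\frac{it}{2\ln(2)\,n}\Big),\qquad \varphi_n(t)\sim\Big(1-\frac{it}{\ln(2)\,n}\Big)^{-2^{L-1}},$$ and in both cases the difference of the two sides is $o(1/n)$. 3. For every $s\in\mathbb R$, $\varphi_n(ns)\to\big(1-\frac{is}{\ln 2}\big)^{-2^{L-1}}$. 4. For every integer $n\geq1$, $t\mapsto\big(1-\frac{it}{\ln(2)\,n}\big)^{-2^{L-1}}$ is the characteristic function of the gamma law of shape $2^{L-1}$ and scale $1/(n\ln 2)$. 5. Conditionally on $\mathcal E$, $n\,\hat I^{L+1}$ converges in distribution to the gamma law of shape $2^{L-1}$ and scale $1/\ln 2$. The limit does not depend on the values of the $p_j$. -/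

import Mathlib

open MeasureTheory ProbabilityTheory Filter Topology Asymptotics

namespace MarketInfo

/-- A prefix: a word of `L` increase indicators (`true` = increase, `false` = no increase).
There are `2 ^ L` of them. -/
abbrev Prefix (L : ℕ) : Type := Fin L → Bool

/-- Shannon entropy (in bits) of the word of length `L + 1` whose prefix has distribution `p` and
whose suffix is, given the prefix `j`, Bernoulli with parameter `q j`.
The convention `0 * log₂ 0 = 0` holds because `Real.logb 2 0 = 0`. -/
noncomputable def fullEntropy {L : ℕ} (p q : Prefix L → ℝ) : ℝ :=
  -∑ j, (p j * q j * Real.logb 2 (p j * q j)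
    + p j * (1 - q j) * Real.logb 2 (p j * (1 - q j)))

/-- Entropy of the word of length `L + 1` in an efficient market with prefix distribution `p`. -/
noncomputable def efficientEntropy {L : ℕ} (p : Prefix L → ℝ) : ℝ :=
  -∑ j, p j * Real.logb 2 (p j / 2)

/-- Market information: entropy of the efficient market minus entropy of the market. -/
noncomputable def marketInfo {L : ℕ} (p q : Prefix L → ℝ) : ℝ :=
  efficientEntropy p - fullEntropy p q

/-- The number `n_j` of observations whose prefix is `j`. -/
def prefixCount {L n : ℕ} (x : Fin n → Prefix L) (j : Prefix L) : ℕ :=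
  (Finset.univ.filter fun k => x k = j).card

/-- The number of observations with prefix `j` and suffix `true` (an increase). -/
def upCount {L n : ℕ} (x : Fin n → Prefix L) (y : Fin n → Bool) (j : Prefix L) : ℕ :=
  (Finset.univ.filter fun k => x k = j ∧ y k = true).card

/-- Empirical prefix probabilities `n_j / n`. -/
noncomputable def empPrefix {L n : ℕ} (x : Fin n → Prefix L) (j : Prefix L) : ℝ :=
  (prefixCount x j : ℝ) / n

/-- Empirical conditional probability of an increase after the prefix `j`. -/
noncomputable def empSuffix {L n : ℕ} (x : Fin n → Prefix L) (y : Fin n → Bool)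
    (j : Prefix L) : ℝ :=
  (upCount x y j : ℝ) / (prefixCount x j : ℝ)

/-- The plug-in estimator of the market information, from `n` observed pairs (prefix, suffix). -/
noncomputable def estimator {L n : ℕ} (x : Fin n → Prefix L) (y : Fin n → Bool) : ℝ :=
  marketInfo (empPrefix x) (empSuffix x y)

/-- The function `g_j(t, x)`, with `p` in the place of `p_j`: the exponential of `i t` times the
summand of the market information at prefix probability `p` and conditional probability `x`. -/
noncomputable def gFun (p t x : ℝ) : ℂ :=
  Complex.exp (Complex.I * t *
    ((p * x * Real.logb 2 (p * x) + p * (1 - x) * Real.logb 2 (p * (1 - x))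
      - p * Real.logb 2 (p / 2) : ℝ) : ℂ))

/-- `(X k, Y k)`, `k < n`, is a sample of pairs (prefix, suffix) with suffix parameters `q`:
given all the prefixes, the suffixes are independent, and a suffix that follows
the prefix `j` is Bernoulli with parameter `q j`. The prefixes have an arbitrary joint law. -/
structure IsSample {L n : ℕ} {Ω : Type*} [MeasurableSpace Ω] (P : Measure Ω)
    (X : Fin n → Ω → Prefix L) (Y : Fin n → Ω → Bool) (q : Prefix L → ℝ) : Prop where
  measurable_prefix : ∀ k, Measurable (X k)
  measurable_suffix : ∀ k, Measurable (Y k)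
  law : ∀ (x : Fin n → Prefix L) (y : Fin n → Bool),
    P.real {ω | (∀ k, X k ω = x k) ∧ ∀ k, Y k ω = y k}
      = P.real {ω | ∀ k, X k ω = x k} * ∏ k, (if y k = true then q (x k) else 1 - q (x k))

/-- The efficient-market null hypothesis: whatever the prefix (of positive probability), an
increase has conditional probability `1 / 2`. -/
def EfficientMarket {L : ℕ} (p q : Prefix L → ℝ) : Prop :=
  ∀ j, p j ≠ 0 → q j = 1 / 2

/-- The event that the empirical prefix probabilities are equal to `p`. -/
def prefixEvent {L n : ℕ} {Ω : Type*} (X : Fin n → Ω → Prefix L) (p : Prefix L → ℝ) : Set Ω :=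
  {ω | ∀ j, empPrefix (fun k => X k ω) j = p j}

/-- The estimator as a random variable. -/
noncomputable def infoHat {L n : ℕ} {Ω : Type*} (X : Fin n → Ω → Prefix L)
    (Y : Fin n → Ω → Bool) (ω : Ω) : ℝ :=
  estimator (fun k => X k ω) (fun k => Y k ω)

/-- Characteristic function of the estimator, conditionally on the event that the empirical
prefix probabilities are equal to `p`. -/
noncomputable def infoCharFun {L n : ℕ} {Ω : Type*} [MeasurableSpace Ω] (P : Measure Ω)
    (X : Fin n → Ω → Prefix L) (Y : Fin n → Ω → Bool) (p : Prefix L → ℝ) (t : ℝ) : ℂ :=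
  ∫ ω, Complex.exp (Complex.I * t * (infoHat X Y ω : ℂ)) ∂(cond P (prefixEvent X p))

end MarketInfo

/-! On the conditioning event the estimator is a sum over the prefixes of `p j / log 2` times the
relative entropy `fairKL` of the empirical suffix law with respect to the fair one. Under the null,
given the prefixes, all suffix words are equally likely, so the numbers of increases after the
various prefixes are independent fair binomials of sizes `c j = p j * n`. Hence the characteristic
function is a product of means over fair coins.

With `s = (2k - c) / c`, `fairKL ((1 + s) / 2)` is `s ^ 2 / 2` up to `s ^ 4 / 3`, while `s ^ 2` has
mean `1 / c` and `s ^ 4` has mean at most `3 / c ^ 2`. At fixed `t` each factor is thus `1 + it / (2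
log 2 n) + O(1 / n ^ 2)`: the weight `p j` cancels against `c j`. Two such factors agree with `(1 -
it / (log 2 n))⁻¹` to the same order.

At `t = n s` the exponent is `s / log 2` times `c j * fairKL`, which by de Moivre's theorem behaves
like half a squared standard Gaussian. Its characteristic function, squared, is `(1 - ia)⁻¹`, so the
`2 ^ L` factors group into `2 ^ (L - 1)` pairs and give the gamma law; Lévy's continuity theorem
concludes. -/

/-! ### Relative entropy near the fair coin -/

/-- The relative entropy, in nats, of the Bernoulli law of parameter `x` with respect to the fair
one. -/
noncomputable def fairKL (x : ℝ) : ℝ := Real.log 2 - Real.binEntropy x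

/-- The difference of the two sides vanishes at `0` and has derivative `x ^ 3 / (1 + x)`, which has
the sign of `x`. -/
lemma Real.log_one_add_le_cubic {s : ℝ} (hs : -1 < s) :
    Real.log (1 + s) ≤ s - s ^ 2 / 2 + s ^ 3 / 3 := by
  let f : ℝ → ℝ := fun s => s - s ^ 2 / 2 + s ^ 3 / 3 - Real.log (1 + s)
  have hd : ∀ x : ℝ, -1 < x → HasDerivAt f (x ^ 3 / (1 + x)) x := by
    intro x hx
    have hx' : 1 + x ≠ 0 := by linarith
    have h1 := (((hasDerivAt_id x).sub (((hasDerivAt_id x).pow 2).div_const 2)).add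
      (((hasDerivAt_id x).pow 3).div_const 3)).sub
      (((hasDerivAt_id x).const_add 1).log hx')
    refine h1.congr_deriv ?_
    simp only [id]
    field_simp
    push_cast
    ring
  have hf0 : f 0 = 0 := by simp [f]
  suffices 0 ≤ f s by simp only [f] at this; linarith
  rw [← hf0]
  rcases le_total 0 s with h | h
  · refine monotoneOn_of_deriv_nonneg (convex_Icc 0 s) ?_ ?_ ?_ ⟨le_rfl, h⟩ ⟨h, le_rfl⟩ h
    · exact fun x hx => (hd x (by linarith [hx.1])).continuousAt.continuousWithinAt
    · rw [interior_Icc]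
      exact fun x hx => (hd x (by linarith [hx.1])).differentiableAt.differentiableWithinAt
    · rw [interior_Icc]
      intro x hx
      rw [(hd x (by linarith [hx.1])).deriv]
      have : 0 < x := hx.1
      positivity
  · refine antitoneOn_of_deriv_nonpos (convex_Icc s 0) ?_ ?_ ?_ ⟨le_rfl, h⟩ ⟨h, le_rfl⟩ h
    · exact fun x hx => (hd x (by linarith [hx.1])).continuousAt.continuousWithinAt
    · rw [interior_Icc]
      exact fun x hx => (hd x (by linarith [hx.1])).differentiableAt.differentiableWithinAt
    · rw [interior_Icc]
      intro x hx
      rw [(hd x (by linarith [hx.1])).deriv]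
      refine div_nonpos_of_nonpos_of_nonneg ?_ (by linarith [hx.1])
      have : x < 0 := hx.2
      nlinarith [mul_pos_of_neg_of_neg this this]

/-- In the centred variable `s` the function is visibly even, so odd terms cancel in the bounds
below. The convention `log 0 = 0` covers `s = ±1`. -/
lemma fairKL_half_one_add (s : ℝ) :
    2 * fairKL ((1 + s) / 2) = (1 + s) * Real.log (1 + s) + (1 - s) * Real.log (1 - s) := by
  have key : ∀ u : ℝ, u * Real.log (u / 2) = u * Real.log u - u * Real.log 2 := by
    intro u
    rcases eq_or_ne u 0 with rfl | hu
    · simp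
    · rw [Real.log_div hu two_ne_zero]; ring
  have h1 := key (1 + s)
  have h2 := key (1 - s)
  rw [fairKL, Real.binEntropy_eq_negMulLog_add_negMulLog_one_sub]
  simp only [Real.negMulLog]
  rw [show 1 - (1 + s) / 2 = (1 - s) / 2 by ring]
  linear_combination h1 + h2

lemma fairKL_le {s : ℝ} (hs : |s| ≤ 1) :
    fairKL ((1 + s) / 2) ≤ s ^ 2 / 2 + s ^ 4 / 3 := by
  have key : ∀ u : ℝ, -1 ≤ u →
      (1 + u) * Real.log (1 + u) ≤ (1 + u) * (u - u ^ 2 / 2 + u ^ 3 / 3) := by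
    intro u hu
    rcases hu.eq_or_lt with rfl | hu
    · simp
    · exact mul_le_mul_of_nonneg_left (Real.log_one_add_le_cubic hu) (by linarith)
  have h1 := key s (abs_le.1 hs).1
  have h2 := key (-s) (by linarith [(abs_le.1 hs).2])
  have h3 := fairKL_half_one_add s
  rw [← sub_eq_add_neg] at h2
  nlinarith

/-- For `|u| < 1`, twice the entropy is `u (log (1 + u) - log (1 - u)) + log (1 - u ^ 2)`, a power
series with terms `u ^ (2k + 2) / ((2k + 1)(k + 1)) ≥ 0`; the term `k = 0` is `u ^ 2`. The endpoints
follow by continuity. -/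
lemma sq_half_le_fairKL {s : ℝ} (hs : |s| ≤ 1) :
    s ^ 2 / 2 ≤ fairKL ((1 + s) / 2) := by
  have main : ∀ u : ℝ, |u| < 1 → u ^ 2 / 2 ≤ fairKL ((1 + u) / 2) := by
    intro u hu
    have hu2 : |u ^ 2| < 1 := by
      rw [abs_pow]; exact pow_lt_one₀ (abs_nonneg _) hu two_ne_zero
    have h1 := (Real.hasSum_log_sub_log_of_abs_lt_one hu).mul_left u
    have h2 := (Real.hasSum_pow_div_log_of_abs_lt_one hu2).mul_left (-1)
    have h3 := h1.add h2
    have hm : 0 < 1 - u := by linarith [(abs_lt.1 hu).2]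
    have hp : 0 < 1 + u := by linarith [(abs_lt.1 hu).1]
    have hlog : Real.log (1 - u ^ 2) = Real.log (1 + u) + Real.log (1 - u) := by
      rw [← Real.log_mul hp.ne' hm.ne']; ring_nf
    have h5 := sum_le_hasSum {0} (fun k _ => ?_) h3
    · simp only [Finset.sum_singleton, hlog] at h5
      have := fairKL_half_one_add u
      norm_num at h5
      nlinarith
    · have : u * (2 * (1 / (2 * (k : ℝ) + 1)) * u ^ (2 * k + 1)) +
          -1 * ((u ^ 2) ^ (k + 1) / ((k : ℝ) + 1))
          = (u ^ (k + 1)) ^ 2 * (1 / ((2 * (k : ℝ) + 1) * (k + 1))) := by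
        field_simp
        ring
      rw [this]
      positivity
  have hcont : Continuous fun u : ℝ => fairKL ((1 + u) / 2) := by
    unfold fairKL; fun_prop
  have hmem : s ∈ closure (Set.Ioo (-1 : ℝ) 1) := by
    rw [closure_Ioo (by norm_num)]; exact abs_le.1 hs
  exact closure_minimal (fun u hu => main u (abs_lt.2 hu))
    (isClosed_le (by fun_prop) hcont) hmem

/-! ### Characteristic functions of the gamma law and of the squared Gaussian -/

lemma integrableOn_pow_mul_cexp_neg_mul_Ioi {b : ℂ} (hb : 0 < b.re) (k : ℕ) :
    IntegrableOn (fun x : ℝ => (x : ℂ) ^ k * Complex.exp (-(b * x))) (Set.Ioi 0) := by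
  have h := integrableOn_rpow_mul_exp_neg_mul_rpow (s := k) (p := 1) (b := b.re)
    (by have := k.cast_nonneg (α := ℝ); linarith) one_pos hb
  refine h.mono' (Continuous.aestronglyMeasurable (by fun_prop)) ?_
  filter_upwards [ae_restrict_mem measurableSet_Ioi] with x hx
  have hx : 0 < x := hx
  simp [Complex.norm_exp, abs_of_pos hx]

/-- Induction on `k` by one integration by parts. The rate `b` is complex so as to absorb the factor
`exp (itx)`. -/
lemma integral_pow_mul_cexp_neg_mul_Ioi {b : ℂ} (hb : 0 < b.re) (k : ℕ) :
    ∫ x : ℝ in Set.Ioi 0, (x : ℂ) ^ k * Complex.exp (-(b * x)) = k.factorial / b ^ (k + 1) := by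
  have hb0 : b ≠ 0 := by rintro rfl; simp at hb
  induction k with
  | zero =>
    have := integral_exp_mul_complex_Ioi (a := -b) (by simpa using hb) 0
    simpa [neg_div_neg_eq] using this
  | succ k ih =>
    have hlim : Tendsto (fun x : ℝ => -((x : ℂ) ^ (k + 1) * Complex.exp (-(b * x)) / b)) atTop
        (𝓝 0) := by
      have h := tendsto_rpow_mul_exp_neg_mul_atTop_nhds_zero ((k + 1 : ℕ) : ℝ) b.re hb
      rw [tendsto_zero_iff_norm_tendsto_zero]
      have h' := h.div_const ‖b‖
      rw [zero_div] at h'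
      refine h'.congr' ?_
      filter_upwards [eventually_gt_atTop 0] with x hx
      simp [Complex.norm_exp, abs_of_pos hx, -Nat.cast_add]
    have hderiv : ∀ x ∈ Set.Ioi (0 : ℝ), HasDerivAt
        (fun x : ℝ => -((x : ℂ) ^ (k + 1) * Complex.exp (-(b * x)) / b))
        ((x : ℂ) ^ (k + 1) * Complex.exp (-(b * x))
          - (k + 1) / b * ((x : ℂ) ^ k * Complex.exp (-(b * x)))) x := by
      intro x _
      have hid : HasDerivAt (fun x : ℝ => (x : ℂ)) 1 x := Complex.ofRealCLM.hasDerivAt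
      have h := (((hid.pow (k + 1)).mul ((hid.const_mul b).neg.cexp)).div_const b).neg
      refine h.congr_deriv ?_
      simp only [Nat.cast_add, Nat.cast_one, Nat.add_sub_cancel, Pi.pow_apply, Pi.neg_apply]
      field_simp
      ring
    have hi1 := integrableOn_pow_mul_cexp_neg_mul_Ioi hb (k + 1)
    have hi2 := (integrableOn_pow_mul_cexp_neg_mul_Ioi hb k).const_mul (((k : ℂ) + 1) / b)
    have h := integral_Ioi_of_hasDerivAt_of_tendsto
      (Continuous.continuousWithinAt (by fun_prop)) hderiv (hi1.sub hi2) hlim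
    rw [integral_sub hi1 hi2, integral_const_mul, ih] at h
    simp only [Complex.ofReal_zero, ne_eq, Nat.add_eq_zero_iff, one_ne_zero, and_false,
      not_false_eq_true, zero_pow, zero_mul, zero_div, neg_zero, sub_zero] at h
    rw [sub_eq_zero.1 h, Nat.factorial_succ]
    push_cast
    field_simp
    ring

/-- The characteristic function of a gamma law of integral shape. -/
lemma charFun_gammaMeasure_natCast {k : ℕ} (hk : 0 < k) {r : ℝ} (hr : 0 < r) (t : ℝ) :
    charFun (gammaMeasure k r) t = (1 - Complex.I * t / r) ^ (-(k : ℤ)) := by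
  obtain ⟨k, rfl⟩ := Nat.exists_eq_succ_of_ne_zero hk.ne'
  set b : ℂ := r - Complex.I * t with hb
  have hbre : 0 < b.re := by simp [hb, hr]
  have hr' : (r : ℂ) ≠ 0 := by exact_mod_cast hr.ne'
  have hb0 : b ≠ 0 := by intro h; rw [h] at hbre; simp at hbre
  rw [charFun_apply_real, gammaMeasure, integral_withDensity_eq_integral_toReal_smul
    (by unfold gammaPDF; fun_prop) (by simp [gammaPDF])]
  have h1 : ∀ x : ℝ, (gammaPDF ((k.succ : ℕ) : ℝ) r x).toReal • Complex.exp (t * x * Complex.I)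
      = (Set.Ici (0 : ℝ)).indicator (fun x : ℝ => ((r : ℂ) ^ (k + 1) / k.factorial) *
        ((x : ℂ) ^ k * Complex.exp (-(b * x)))) x := by
    intro x
    by_cases hx : 0 ≤ x
    · rw [Set.indicator_of_mem (by exact hx), gammaPDF_of_nonneg hx, ENNReal.toReal_ofReal]
      · rw [Complex.real_smul]
        have e : (Real.Gamma ((k.succ : ℕ) : ℝ)) = k.factorial := by
          rw [Nat.cast_succ, Real.Gamma_nat_eq_factorial]
        rw [e, Real.rpow_natCast, show ((k.succ : ℕ) : ℝ) - 1 = (k : ℕ) by simp,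
          Real.rpow_natCast]
        push_cast
        rw [show -(b * x) = -(r * x) + t * x * Complex.I by rw [hb]; ring, Complex.exp_add,
          Nat.succ_eq_add_one]
        ring
      · have := Real.Gamma_pos_of_pos (s := ((k.succ : ℕ) : ℝ)) (by positivity)
        positivity
    · rw [Set.indicator_of_notMem (by exact hx), gammaPDF_of_neg (not_le.1 hx)]
      simp
  simp_rw [h1]
  rw [integral_indicator measurableSet_Ici, integral_Ici_eq_integral_Ioi, integral_const_mul,
    integral_pow_mul_cexp_neg_mul_Ioi hbre]
  have h2 : 1 - Complex.I * t / r = b / r := by rw [hb]; field_simp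
  have hf : (k.factorial : ℂ) ≠ 0 := by exact_mod_cast k.factorial_ne_zero
  rw [h2, zpow_neg, zpow_natCast, div_pow]
  field_simp

/-- The characteristic function of half the square of a standard Gaussian variable, squared. -/
lemma sq_integral_cexp_sq_gaussianReal (a : ℝ) :
    (∫ x, Complex.exp (Complex.I * (a * x ^ 2 / 2 : ℝ)) ∂(gaussianReal 0 1)) ^ 2
      = (1 - Complex.I * a)⁻¹ := by
  set b : ℂ := (1 - Complex.I * a) / 2 with hb
  have hbre : 0 < b.re := by simp [hb]
  have hb0 : b ≠ 0 := by intro h; rw [h] at hbre; simp at hbre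
  rw [integral_gaussianReal_eq_integral_smul one_ne_zero]
  have h1 : ∀ x : ℝ, gaussianPDFReal 0 1 x • Complex.exp (Complex.I * (a * x ^ 2 / 2 : ℝ))
      = ((√(2 * Real.pi))⁻¹ : ℝ) * Complex.exp (-b * (x : ℂ) ^ 2) := by
    intro x
    simp only [gaussianPDFReal, Complex.real_smul, NNReal.coe_one, mul_one, sub_zero]
    push_cast
    rw [mul_assoc, ← Complex.exp_add, hb]
    congr 2
    ring
  simp_rw [h1]
  -- Squaring removes the exponent `1 / 2` of `π / b`, so no branch of the square root has to be
  -- followed.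
  rw [integral_const_mul, integral_gaussian_complex hbre, mul_pow, ← Complex.ofReal_pow, inv_pow,
    Real.sq_sqrt (by positivity), ← Complex.cpow_nat_mul]
  have hpi : (Real.pi : ℂ) ≠ 0 := by exact_mod_cast Real.pi_ne_zero
  have h2 : 1 - Complex.I * a = 2 * b := by rw [hb]; ring
  rw [h2]
  norm_num
  field_simp

/-! ### Fair coin tosses: moments and de Moivre's theorem -/

section FairMean

variable {E : Type*} [NormedAddCommGroup E] [NormedSpace ℝ E]

/-- The mean of `f` at the number of heads in `n` tosses of a fair coin. -/
noncomputable def fairMean (n : ℕ) (f : ℕ → E) : E :=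
  ((2 : ℝ) ^ n)⁻¹ • ∑ v : Fin n → Bool, f (Finset.univ.filter fun k => v k = true).card

lemma fairMean_zero (f : ℕ → E) : fairMean 0 f = f 0 := by simp [fairMean]

/-- Conditioning on the first toss; the moments and the characteristic function then follow by
induction. -/
lemma fairMean_succ (n : ℕ) (f : ℕ → E) :
    fairMean (n + 1) f = (1 / 2 : ℝ) • (fairMean n (fun k => f (k + 1)) + fairMean n f) := by
  have h : ∑ v : Fin (n + 1) → Bool, f (Finset.univ.filter fun k => v k = true).card
      = ∑ v : Fin n → Bool, f ((Finset.univ.filter fun k => v k = true).card + 1)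
        + ∑ v : Fin n → Bool, f (Finset.univ.filter fun k => v k = true).card := by
    rw [← (Fin.consEquiv fun _ : Fin (n + 1) => Bool).sum_comp, Fintype.sum_prod_type,
      Fintype.sum_bool]
    congr 1 <;> refine Finset.sum_congr rfl fun v _ => ?_
    · congr 1
      exact (Fin.card_filter_univ_succ _).trans (by simp [Fin.consEquiv])
    · congr 1
      exact (Fin.card_filter_univ_succ _).trans (by simp [Fin.consEquiv])
  rw [fairMean, h, fairMean, fairMean, ← smul_add, smul_smul]
  congr 1
  rw [pow_succ, mul_inv]
  ring

lemma fairMean_add (n : ℕ) (f g : ℕ → E) :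
    fairMean n (fun k => f k + g k) = fairMean n f + fairMean n g := by
  simp [fairMean, Finset.sum_add_distrib]

lemma fairMean_sub (n : ℕ) (f g : ℕ → E) :
    fairMean n (fun k => f k - g k) = fairMean n f - fairMean n g := by
  simp [fairMean, Finset.sum_sub_distrib, smul_sub]

lemma fairMean_const (n : ℕ) (c : E) : fairMean n (fun _ => c) = c := by
  induction n with
  | zero => exact fairMean_zero _
  | succ n ih => rw [fairMean_succ, ih, ← two_smul ℝ c, smul_smul]; norm_num

lemma fairMean_const_mul {𝕜 : Type*} [RCLike 𝕜] (n : ℕ) (c : 𝕜) (f : ℕ → 𝕜) :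
    fairMean n (fun k => c * f k) = c * fairMean n f := by
  simp [fairMean, Finset.mul_sum]

lemma fairMean_ofReal (n : ℕ) (f : ℕ → ℝ) :
    fairMean n (fun k => (f k : ℂ)) = (fairMean n f : ℝ) := by
  simp [fairMean]

lemma norm_fairMean_le {n : ℕ} {f : ℕ → E} {g : ℕ → ℝ} (h : ∀ k ≤ n, ‖f k‖ ≤ g k) :
    ‖fairMean n f‖ ≤ fairMean n g := by
  rw [fairMean, fairMean, norm_smul, Real.norm_of_nonneg (by positivity), smul_eq_mul]
  gcongr
  refine norm_sum_le_of_le _ fun v _ => h _ ?_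
  exact (Finset.card_filter_le _ _).trans (by simp)

/-- `2k - n` is the position of a simple random walk; in the average over a step `±1` the odd terms
cancel. -/
lemma fairMean_sq (n : ℕ) : fairMean n (fun k => (2 * k - n : ℝ) ^ 2) = n := by
  induction n with
  | zero => simp [fairMean_zero]
  | succ n ih =>
    rw [fairMean_succ, ← fairMean_add]
    have h : (fun k : ℕ => (2 * ((k + 1 : ℕ) : ℝ) - (n + 1 : ℕ)) ^ 2
          + (2 * (k : ℝ) - (n + 1 : ℕ)) ^ 2)
        = fun k : ℕ => 2 * (2 * k - n : ℝ) ^ 2 + 2 := by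
      funext k; push_cast; ring
    rw [h, fairMean_add, fairMean_const, fairMean_const_mul, ih]
    push_cast
    simp only [smul_eq_mul]
    ring

lemma fairMean_pow_four (n : ℕ) :
    fairMean n (fun k => (2 * k - n : ℝ) ^ 4) = 3 * n ^ 2 - 2 * n := by
  induction n with
  | zero => simp [fairMean_zero]
  | succ n ih =>
    rw [fairMean_succ, ← fairMean_add]
    have h : (fun k : ℕ => (2 * ((k + 1 : ℕ) : ℝ) - (n + 1 : ℕ)) ^ 4
          + (2 * (k : ℝ) - (n + 1 : ℕ)) ^ 4)
        = fun k : ℕ => 2 * (2 * k - n : ℝ) ^ 4 + 12 * (2 * k - n : ℝ) ^ 2 + 2 := by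
      funext k; push_cast; ring
    rw [h, fairMean_add, fairMean_add, fairMean_const, fairMean_const_mul, fairMean_const_mul, ih,
      fairMean_sq]
    push_cast
    simp only [smul_eq_mul]
    ring

lemma fairMean_cexp (n : ℕ) (θ : ℝ) :
    fairMean n (fun k => Complex.exp ((θ * (2 * k - n) : ℝ) * Complex.I)) = Complex.cos θ ^ n := by
  induction n with
  | zero => simp [fairMean_zero]
  | succ n ih =>
    rw [fairMean_succ, ← fairMean_add]
    have h : (fun k : ℕ =>
          Complex.exp ((θ * (2 * ((k + 1 : ℕ) : ℝ) - (n + 1 : ℕ)) : ℝ) * Complex.I)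
          + Complex.exp ((θ * (2 * (k : ℝ) - (n + 1 : ℕ)) : ℝ) * Complex.I))
        = fun k : ℕ => (2 * Complex.cos θ) * Complex.exp ((θ * (2 * k - n) : ℝ) * Complex.I) := by
      funext k
      rw [Complex.two_cos, add_mul, ← Complex.exp_add, ← Complex.exp_add]
      congr 2 <;> (push_cast; ring)
    rw [h, fairMean_const_mul, ih, Complex.real_smul]
    push_cast
    ring

/-- The law of the standardized number of heads in `n` tosses of a fair coin. -/
noncomputable def fairLaw (n : ℕ) : Measure ℝ :=
  (PMF.uniformOfFintype (Fin n → Bool)).toMeasure.map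
    fun v => (2 * (Finset.univ.filter fun k => v k = true).card - n) / √n

instance (n : ℕ) : IsProbabilityMeasure (fairLaw n) :=
  Measure.isProbabilityMeasure_map (measurable_of_finite _).aemeasurable

lemma integral_fairLaw (n : ℕ) {g : ℝ → ℂ} (hg : Continuous g) :
    ∫ x, g x ∂(fairLaw n) = fairMean n fun k => g ((2 * k - n) / √n) := by
  rw [fairLaw, integral_map (measurable_of_finite _).aemeasurable hg.aestronglyMeasurable,
    PMF.integral_eq_sum, fairMean, Finset.smul_sum]
  simp

/-- `cos (t / √n) = 1 - t ^ 2 / (2n) + O(1 / n ^ 2)`, and an error `o(1 / n)` in the base does not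
affect the limit of the `n`-th power. -/
lemma tendsto_cos_div_sqrt_pow (t : ℝ) :
    Tendsto (fun n : ℕ => Complex.cos ((t / √n : ℝ)) ^ n) atTop (𝓝 (Complex.exp (-t ^ 2 / 2))) := by
  refine Complex.tendsto_pow_exp_of_isLittleO_sub_add_div _ ?_
  refine IsBigO.trans_isLittleO (g := fun n : ℕ => ((1 : ℝ) / n) ^ 2) ?_ ?_
  · refine IsBigO.of_bound (t ^ 4) ?_
    have h0 : Tendsto (fun n : ℕ => t / √n) atTop (𝓝 0) :=
      tendsto_const_nhds.div_atTop (Real.tendsto_sqrt_atTop.comp tendsto_natCast_atTop_atTop)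
    have h1 : ∀ᶠ n : ℕ in atTop, |t / √n| < 1 := by
      have := h0.abs; rw [abs_zero] at this
      exact this.eventually_lt_const one_pos
    filter_upwards [h1, eventually_gt_atTop 0] with n hn hn0
    have hn' : (0 : ℝ) < n := by exact_mod_cast hn0
    have hb := Real.cos_bound hn.le
    have e : Complex.cos ((t / √n : ℝ)) - (1 + -(t : ℂ) ^ 2 / 2 / n)
        = ((Real.cos (t / √n) - (1 - (t / √n) ^ 2 / 2) : ℝ) : ℂ) := by
      rw [div_pow, Real.sq_sqrt hn'.le]
      push_cast
      ring
    have e4 : |t / √n| ^ 4 = t ^ 4 * (1 / (n : ℝ)) ^ 2 := by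
      rw [(by decide : Even 4).pow_abs, div_pow, show √(n : ℝ) ^ 4 = (√(n : ℝ) ^ 2) ^ 2 by ring,
        Real.sq_sqrt hn'.le]
      ring
    rw [e, Complex.norm_real, Real.norm_eq_abs, Real.norm_of_nonneg (by positivity), ← e4]
    refine hb.trans ?_
    nlinarith [pow_nonneg (abs_nonneg (t / √(n : ℝ))) 4]
  · have h : Tendsto (fun n : ℕ => (1 : ℝ) / n) atTop (𝓝 0) := tendsto_one_div_atTop_nhds_zero_nat
    have h2 : (fun n : ℕ => ((1 : ℝ) / n) ^ 2) =o[atTop] fun n : ℕ => (1 : ℝ) / n := by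
      have := ((isLittleO_one_iff ℝ).2 h).mul_isBigO (isBigO_refl (fun n : ℕ => (1 : ℝ) / n) atTop)
      simpa [sq] using this
    refine h2.trans_isBigO (IsBigO.of_bound 1 (Eventually.of_forall fun n => ?_))
    simp

/-- De Moivre's theorem for a fair coin. -/
lemma tendsto_fairMean_gaussianReal {g : ℝ → ℂ} (hg : Continuous g) {C : ℝ}
    (hC : ∀ x, ‖g x‖ ≤ C) :
    Tendsto (fun n : ℕ => fairMean n fun k => g ((2 * k - n) / √n)) atTop
      (𝓝 (∫ x, g x ∂(gaussianReal 0 1))) := by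
  let ν : ℕ → ProbabilityMeasure ℝ := fun n => ⟨fairLaw n, inferInstance⟩
  let ν₀ : ProbabilityMeasure ℝ := ⟨gaussianReal 0 1, inferInstance⟩
  have h : Tendsto ν atTop (𝓝 ν₀) := by
    refine ProbabilityMeasure.tendsto_iff_tendsto_charFun.2 fun t => ?_
    simp only [ν, ν₀, ProbabilityMeasure.coe_mk]
    rw [charFun_gaussianReal]
    convert tendsto_cos_div_sqrt_pow t using 2 with n
    · rw [charFun_apply_real, integral_fairLaw n (by fun_prop), ← fairMean_cexp]
      congr 1
      funext k
      congr 2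
      push_cast
      ring
    · simp [neg_div]
  rw [ProbabilityMeasure.tendsto_iff_forall_integral_rclike_tendsto ℂ] at h
  have := h (BoundedContinuousFunction.ofNormedAddCommGroup g hg C hC)
  simpa [ν, ν₀, integral_fairLaw _ hg] using this

end FairMean

/-! ### The entropy of one coin at fixed argument and at scale `n` -/

/-- Taylor's bound for `|x| ≤ 1`; beyond, the triangle inequality and `2 + |x| ≤ 3 x ^ 2`. -/
lemma norm_cexp_I_mul_sub_one_sub_le (x : ℝ) :
    ‖Complex.exp (Complex.I * x) - (1 + Complex.I * x)‖ ≤ 3 * x ^ 2 := by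
  rcases le_total |x| 1 with h | h
  · have := Complex.norm_exp_sub_one_sub_id_le (x := Complex.I * x) (by simpa using h)
    rw [← sub_sub]
    refine this.trans ?_
    simp only [norm_mul, Complex.norm_I, one_mul, Complex.norm_real, Real.norm_eq_abs, sq_abs]
    nlinarith [sq_nonneg x]
  · have h1 := norm_sub_le (Complex.exp (Complex.I * x)) (1 + Complex.I * x)
    have h2 := norm_add_le (1 : ℂ) (Complex.I * x)
    rw [Complex.norm_exp_I_mul_ofReal] at h1
    simp only [norm_mul, Complex.norm_I, one_mul, Complex.norm_real, Real.norm_eq_abs, norm_one]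
      at h2
    rw [← sq_abs]
    nlinarith

lemma norm_cexp_I_mul_sub_cexp_I_mul_le (x y : ℝ) :
    ‖Complex.exp (Complex.I * x) - Complex.exp (Complex.I * y)‖ ≤ |x - y| := by
  have h : Complex.exp (Complex.I * x) - Complex.exp (Complex.I * y)
      = Complex.exp (Complex.I * y) * (Complex.exp (Complex.I * ((x - y : ℝ) : ℂ)) - 1) := by
    rw [mul_sub, ← Complex.exp_add]
    push_cast
    ring_nf
  rw [h, norm_mul, Complex.norm_exp_I_mul_ofReal, one_mul]
  exact Real.norm_exp_I_mul_ofReal_sub_one_le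

lemma abs_fairKL_sub_le {s : ℝ} (hs : |s| ≤ 1) :
    |fairKL ((1 + s) / 2) - s ^ 2 / 2| ≤ s ^ 4 / 3 := by
  have h1 := fairKL_le hs
  have h2 := sq_half_le_fairKL hs
  rw [abs_of_nonneg (by linarith)]
  linarith

lemma abs_two_mul_sub_div_le_one {n k : ℕ} (hk : k ≤ n) : |(2 * k - n : ℝ) / n| ≤ 1 := by
  have hk' : (k : ℝ) ≤ n := by exact_mod_cast hk
  have hk0 : (0 : ℝ) ≤ k := k.cast_nonneg
  rw [abs_div, Nat.abs_cast]
  exact div_le_one_of_le₀ (abs_le.2 ⟨by linarith, by linarith⟩) (by positivity)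

lemma natCast_div_eq_half_one_add {n : ℕ} (hn : 0 < n) (k : ℕ) :
    (k : ℝ) / n = (1 + (2 * k - n : ℝ) / n) / 2 := by
  have : (n : ℝ) ≠ 0 := by exact_mod_cast hn.ne'
  field_simp
  ring

lemma fairMean_div_pow_four_le {n : ℕ} (hn : 0 < n) :
    fairMean n (fun k => ((2 * k - n : ℝ) / n) ^ 4) ≤ 3 / (n : ℝ) ^ 2 := by
  have hn' : (0 : ℝ) < n := by exact_mod_cast hn
  have h : (fun k : ℕ => ((2 * k - n : ℝ) / n) ^ 4)
      = fun k : ℕ => ((n : ℝ) ^ 4)⁻¹ * (2 * k - n : ℝ) ^ 4 := by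
    funext k; rw [div_pow]; ring
  rw [h, fairMean_const_mul, fairMean_pow_four, inv_mul_le_iff₀ (by positivity)]
  have : (n : ℝ) ^ 4 * (3 / (n : ℝ) ^ 2) = 3 * n ^ 2 := by field_simp
  rw [this]
  linarith

/-- First-order expansion of the characteristic function of the relative entropy of the empirical
law of a fair coin. -/
lemma norm_fairMean_cexp_fairKL_sub_le {n : ℕ} (hn : 0 < n) (a : ℝ) :
    ‖fairMean n (fun k => Complex.exp (Complex.I * (a * fairKL (k / n) : ℝ)))
      - (1 + Complex.I * a / (2 * n))‖ ≤ (9 * a ^ 2 + |a|) / (n : ℝ) ^ 2 := by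
  have hn' : (n : ℝ) ≠ 0 := by exact_mod_cast hn.ne'
  have hnc : (n : ℂ) ≠ 0 := by exact_mod_cast hn.ne'
  have h1 : fairMean n (fun k => 1 + Complex.I * a / 2 * ((((2 * k - n : ℝ) / n) ^ 2 : ℝ) : ℂ))
      = 1 + Complex.I * a / (2 * n) := by
    rw [fairMean_add, fairMean_const, fairMean_const_mul, fairMean_ofReal]
    have h : (fun k : ℕ => ((2 * k - n : ℝ) / n) ^ 2)
        = fun k : ℕ => ((n : ℝ) ^ 2)⁻¹ * (2 * k - n : ℝ) ^ 2 := by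
      funext k; rw [div_pow]; ring
    rw [h, fairMean_const_mul, fairMean_sq]
    push_cast
    field_simp
  rw [← h1, ← fairMean_sub]
  -- `3 a ^ 2` comes from the exponential remainder, as `fairKL ≤ s ^ 2`; `|a| / 3` comes from
  -- replacing `fairKL` by `s ^ 2 / 2`. The fourth moment `3 / n ^ 2` then gives the stated
  -- constant.
  refine (norm_fairMean_le
    (g := fun k => (3 * a ^ 2 + |a| / 3) * ((2 * k - n : ℝ) / n) ^ 4) ?_).trans ?_
  · intro k hk
    rw [natCast_div_eq_half_one_add hn]
    have hs := abs_two_mul_sub_div_le_one hk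
    generalize (2 * k - n : ℝ) / n = s at hs ⊢
    have h2 := norm_cexp_I_mul_sub_one_sub_le (a * fairKL ((1 + s) / 2))
    have h3 := abs_fairKL_sub_le hs
    have h4 := fairKL_le hs
    have h5 := sq_half_le_fairKL hs
    have hs2 : s ^ 2 ≤ 1 := by rw [← sq_abs]; exact pow_le_one₀ (abs_nonneg _) hs
    have h6 : fairKL ((1 + s) / 2) ≤ s ^ 2 := by nlinarith [sq_nonneg s]
    have h7 : fairKL ((1 + s) / 2) ^ 2 ≤ s ^ 4 := by
      have := pow_le_pow_left₀ (by nlinarith [sq_nonneg s]) h6 2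
      nlinarith
    generalize fairKL ((1 + s) / 2) = J at *
    have h8 : Complex.exp (Complex.I * (a * J : ℝ)) - (1 + Complex.I * a / 2 * ((s ^ 2 : ℝ) : ℂ))
        = (Complex.exp (Complex.I * (a * J : ℝ)) - (1 + Complex.I * (a * J : ℝ)))
          + Complex.I * ((a * (J - s ^ 2 / 2) : ℝ) : ℂ) := by
      push_cast; ring
    rw [h8]
    refine (norm_add_le _ _).trans ?_
    rw [norm_mul, Complex.norm_I, one_mul, Complex.norm_real, Real.norm_eq_abs, abs_mul]
    have h9 : 3 * (a * J) ^ 2 ≤ 3 * a ^ 2 * s ^ 4 := by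
      rw [mul_pow, ← mul_assoc]; gcongr
    have h10 := mul_le_mul_of_nonneg_left h3 (abs_nonneg a)
    linarith
  · rw [fairMean_const_mul]
    refine (mul_le_mul_of_nonneg_left (fairMean_div_pow_four_le hn) (by positivity)).trans_eq ?_
    ring

/-- The characteristic function of `n` times the relative entropy of the empirical law of a fair
coin converges to that of half the square of a standard Gaussian variable. -/
lemma tendsto_fairMean_cexp_mul_fairKL (a : ℝ) :
    Tendsto (fun n : ℕ => fairMean n
        (fun k => Complex.exp (Complex.I * (a * n * fairKL (k / n) : ℝ)))) atTop
      (𝓝 (∫ x, Complex.exp (Complex.I * (a * x ^ 2 / 2 : ℝ)) ∂(gaussianReal 0 1))) := by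
  have h := tendsto_fairMean_gaussianReal
    (g := fun x => Complex.exp (Complex.I * (a * x ^ 2 / 2 : ℝ))) (by fun_prop) (C := 1)
    (fun x => (Complex.norm_exp_I_mul_ofReal _).le)
  -- Replacing `fairKL` by its quadratic term costs at most `|a| n / 3` times the mean of `s ^ 4`,
  -- hence at most `|a| / n`.
  refine tendsto_of_tendsto_of_dist h ?_
  have h0 : Tendsto (fun n : ℕ => |a| / (n : ℝ)) atTop (𝓝 0) :=
    tendsto_const_nhds.div_atTop tendsto_natCast_atTop_atTop
  refine squeeze_zero' (Eventually.of_forall fun _ => dist_nonneg) ?_ h0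
  filter_upwards [eventually_gt_atTop 0] with n hn
  have hn' : (0 : ℝ) < n := by exact_mod_cast hn
  rw [dist_comm, dist_eq_norm, ← fairMean_sub]
  refine (norm_fairMean_le
    (g := fun k => (|a| * n / 3) * ((2 * k - n : ℝ) / n) ^ 4) ?_).trans ?_
  · intro k hk
    refine (norm_cexp_I_mul_sub_cexp_I_mul_le _ _).trans ?_
    rw [natCast_div_eq_half_one_add hn]
    have hs := abs_two_mul_sub_div_le_one hk
    have e : ((2 * k - n : ℝ) / √n) ^ 2 = n * ((2 * k - n : ℝ) / n) ^ 2 := by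
      rw [div_pow, div_pow, Real.sq_sqrt hn'.le]; field_simp
    rw [e]
    generalize (2 * k - n : ℝ) / n = s at hs ⊢
    have h3 := abs_fairKL_sub_le hs
    have e2 : a * n * fairKL ((1 + s) / 2) - a * (n * s ^ 2) / 2
        = a * n * (fairKL ((1 + s) / 2) - s ^ 2 / 2) := by ring
    rw [e2, abs_mul, abs_mul, abs_of_pos hn']
    refine (mul_le_mul_of_nonneg_left h3 (by positivity)).trans_eq ?_
    ring
  · rw [fairMean_const_mul]
    refine (mul_le_mul_of_nonneg_left (fairMean_div_pow_four_le hn) (by positivity)).trans_eq ?_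
    field_simp

/-! ### The sample conditionally on the prefixes -/

open MarketInfo

/-- A sum over all words of a product over the blocks of a partition factorizes. -/
lemma sum_prod_card_fiber {α ι : Type*} [Fintype α] [DecidableEq α] [Fintype ι] [DecidableEq ι]
    (x : α → ι) (f : ι → ℕ → ℂ) :
    ∑ y : α → Bool, ∏ j, f j (Finset.univ.filter fun k => x k = j ∧ y k = true).card
      = ∏ j, ∑ v : {k // x k = j} → Bool, f j (Finset.univ.filter fun k => v k = true).card := by
  -- A word is the family of its restrictions to the fibres of `x`; distributing the product of sums
  -- gives a sum over such families.
  let e : (α → Bool) ≃ ((j : ι) → {k // x k = j} → Bool) :=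
    { toFun := fun y j k => y k
      invFun := fun v k => v (x k) ⟨k, rfl⟩
      left_inv := fun y => rfl
      right_inv := fun v => by
        funext j ⟨k, hk⟩
        subst hk
        rfl }
  rw [Finset.prod_univ_sum, Fintype.piFinset_univ, ← e.sum_comp]
  refine Finset.sum_congr rfl fun y _ => Finset.prod_congr rfl fun j _ => ?_
  congr 1
  refine Finset.card_bij' (fun k hk => ⟨k, (Finset.mem_filter.1 hk).2.1⟩) (fun k _ => k.1)
    (fun k hk => ?_) (fun k hk => ?_) (fun _ _ => rfl) (fun _ _ => rfl)
  · simpa [e] using (Finset.mem_filter.1 hk).2.2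
  · simpa [e, k.2] using hk

lemma fairMean_eq_sum_of_card {α : Type*} [Fintype α] [DecidableEq α] {n : ℕ}
    (h : Fintype.card α = n) (f : ℕ → ℂ) :
    fairMean n f
      = ((2 : ℝ) ^ n)⁻¹ • ∑ v : α → Bool, f (Finset.univ.filter fun k => v k = true).card := by
  have e : Fin n ≃ α := (Fintype.equivFinOfCardEq h).symm
  rw [fairMean]
  congr 1
  refine Fintype.sum_equiv (e.arrowCongr (Equiv.refl Bool)) _ _ fun v => ?_
  congr 1
  refine Finset.card_equiv e fun k => ?_
  simp

/-- Given the prefixes, the numbers of increases after the various prefixes are independent and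
binomial. -/
lemma mean_prod_upCount {L n : ℕ} (x : Fin n → Prefix L) (f : Prefix L → ℕ → ℂ) :
    ((2 : ℝ) ^ n)⁻¹ • ∑ y : Fin n → Bool, ∏ j, f j (upCount x y j)
      = ∏ j, fairMean (prefixCount x j) (f j) := by
  have hc : ∀ j, Fintype.card {k // x k = j} = prefixCount x j := fun j => by
    rw [Fintype.card_subtype, prefixCount]
  -- The block sizes add up to `n`, so `2 ^ (-n)` splits into the normalizations of the blocks.
  have h2 : ∑ j, prefixCount x j = n := by
    have := Finset.card_eq_sum_card_fiberwise (f := x) (s := Finset.univ) (t := Finset.univ)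
      (fun _ _ => Finset.mem_coe.2 (Finset.mem_univ _))
    simpa [prefixCount] using this.symm
  simp_rw [upCount]
  rw [sum_prod_card_fiber, Finset.prod_congr rfl fun j _ => fairMean_eq_sum_of_card (hc j) (f j)]
  simp_rw [Complex.real_smul]
  rw [Finset.prod_mul_distrib]
  congr 1
  push_cast
  rw [Finset.prod_inv_distrib, Finset.prod_pow_eq_pow_sum, h2]

lemma measureReal_cond_apply {Ω : Type*} [MeasurableSpace Ω] {P : Measure Ω} {s : Set Ω}
    (hs : MeasurableSet s) (t : Set Ω) : (cond P s).real t = (P.real s)⁻¹ * P.real (s ∩ t) := by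
  rw [measureReal_def, cond_apply hs, ENNReal.toReal_mul, ENNReal.toReal_inv]
  rfl

section Sample

variable {L n : ℕ} {Ω : Type*} [MeasurableSpace Ω] {P : Measure Ω}
  {X : Fin n → Ω → Prefix L} {Y : Fin n → Ω → Bool} {p q : Prefix L → ℝ}

lemma measurable_infoHat (hs : IsSample P X Y q) : Measurable (infoHat X Y) := by
  have h : Measurable fun ω => ((fun k => X k ω, fun k => Y k ω) :
      (Fin n → Prefix L) × (Fin n → Bool)) :=
    (measurable_pi_lambda _ hs.measurable_prefix).prodMk
      (measurable_pi_lambda _ hs.measurable_suffix)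
  have hm : Measurable fun z : (Fin n → Prefix L) × (Fin n → Bool) => estimator z.1 z.2 :=
    measurable_of_finite _
  have := hm.comp h
  unfold infoHat
  exact this

lemma measurableSet_prefixEvent (hs : IsSample P X Y q) : MeasurableSet (prefixEvent X p) := by
  have h : Measurable fun ω => (fun k => X k ω : Fin n → Prefix L) :=
    measurable_pi_lambda _ hs.measurable_prefix
  exact h (Set.toFinite {x : Fin n → Prefix L | ∀ j, empPrefix x j = p j}).measurableSet

/-- Means of functions of the sample, conditionally on the prefix event. -/
lemma integral_cond_prefixEvent (hs : IsSample P X Y q) (hq : ∀ j, q j = 1 / 2)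
    (F : (Fin n → Prefix L) → (Fin n → Bool) → ℂ) :
    ∫ ω, F (fun k => X k ω) (fun k => Y k ω) ∂(cond P (prefixEvent X p))
      = ∑ x : Fin n → Prefix L, ((cond P (prefixEvent X p)).real {ω | ∀ k, X k ω = x k} : ℂ) *
          (((2 : ℝ) ^ n)⁻¹ • ∑ y : Fin n → Bool, F x y) := by
  have hX : Measurable fun ω => (fun k => X k ω : Fin n → Prefix L) :=
    measurable_pi_lambda _ hs.measurable_prefix
  have hY : Measurable fun ω => (fun k => Y k ω : Fin n → Bool) :=
    measurable_pi_lambda _ hs.measurable_suffix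
  have hE := measurableSet_prefixEvent (p := p) hs
  have hZ := hX.prodMk hY
  have h1 := integral_map (μ := cond P (prefixEvent X p)) hZ.aemeasurable
    (f := fun z => F z.1 z.2) (measurable_of_finite _).aestronglyMeasurable
  rw [← h1, integral_fintype .of_finite, Fintype.sum_prod_type]
  refine Finset.sum_congr rfl fun x _ => ?_
  rw [Finset.smul_sum, Finset.mul_sum]
  refine Finset.sum_congr rfl fun y _ => ?_
  have h2 : ((cond P (prefixEvent X p)).map fun ω => ((fun k => X k ω, fun k => Y k ω) :
      (Fin n → Prefix L) × (Fin n → Bool))).real {(x, y)}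
      = (cond P (prefixEvent X p)).real {ω | ∀ k, X k ω = x k} * ((2 : ℝ) ^ n)⁻¹ := by
    rw [map_measureReal_apply hZ (measurableSet_singleton _), measureReal_cond_apply hE,
      measureReal_cond_apply hE, mul_assoc]
    congr 1
    have e1 : ((fun ω => ((fun k => X k ω, fun k => Y k ω) :
        (Fin n → Prefix L) × (Fin n → Bool))) ⁻¹' {(x, y)})
        = {ω | (∀ k, X k ω = x k) ∧ ∀ k, Y k ω = y k} := by
      ext ω; simp [funext_iff]
    rw [e1]
    -- The event depends on the prefixes alone: a prefix word either lies in it, or is incompatible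
    -- with it and both sides vanish.
    by_cases hx : ∀ j, empPrefix x j = p j
    · have hsub : {ω | ∀ k, X k ω = x k} ⊆ prefixEvent X p := by
        intro ω hω j
        have : (fun k => X k ω) = x := funext hω
        rw [this]; exact hx j
      rw [Set.inter_eq_right.2 hsub, Set.inter_eq_right.2 fun ω hω => hsub hω.1, hs.law]
      congr 1
      rw [Finset.prod_congr rfl (g := fun _ => (1 / 2 : ℝ))
        (fun k _ => by rw [hq]; split_ifs <;> norm_num)]
      simp
    · have hdis : prefixEvent X p ∩ {ω | ∀ k, X k ω = x k} = ∅ := by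
        ext ω
        simp only [Set.mem_inter_iff, Set.mem_empty_iff_false, iff_false, not_and]
        intro h hω
        have : (fun k => X k ω) = x := funext hω
        exact hx fun j => by rw [← this]; exact h j
      have hdis2 : prefixEvent X p ∩ {ω | (∀ k, X k ω = x k) ∧ ∀ k, Y k ω = y k} = ∅ :=
        Set.subset_empty_iff.1 (hdis ▸ Set.inter_subset_inter_right _ fun ω hω => hω.1)
      rw [hdis, hdis2]
      simp
  rw [h2, Complex.real_smul, Complex.real_smul]
  push_cast
  ring

/-- Conditionally on the prefix event, the numbers of increases after the various prefixes are
independent and binomial. -/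
lemma integral_cond_prod_upCount (hs : IsSample P X Y q) (hq : ∀ j, q j = 1 / 2)
    [IsFiniteMeasure P] (hE : P (prefixEvent X p) ≠ 0) {c : Prefix L → ℕ} (hn : 0 < n)
    (hc : ∀ j, (c j : ℝ) = p j * n) (f : Prefix L → ℕ → ℂ) :
    ∫ ω, ∏ j, f j (upCount (fun k => X k ω) (fun k => Y k ω) j) ∂(cond P (prefixEvent X p))
      = ∏ j, fairMean (c j) (f j) := by
  have : IsProbabilityMeasure (cond P (prefixEvent X p)) := cond_isProbabilityMeasure hE
  have hEm := measurableSet_prefixEvent (p := p) hs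
  have hone := integral_cond_prefixEvent (p := p) hs hq fun _ _ => 1
  rw [integral_cond_prefixEvent hs hq fun x y => ∏ j, f j (upCount x y j)]
  -- The event forces the counts `c j`, so the product is the same for every prefix word of positive
  -- weight and leaves the sum; by `hone` the weights sum to `1`.
  have h : ∀ x : Fin n → Prefix L,
      ((cond P (prefixEvent X p)).real {ω | ∀ k, X k ω = x k} : ℂ) *
          (((2 : ℝ) ^ n)⁻¹ • ∑ y : Fin n → Bool, ∏ j, f j (upCount x y j))
      = ((cond P (prefixEvent X p)).real {ω | ∀ k, X k ω = x k} : ℂ) *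
          (((2 : ℝ) ^ n)⁻¹ • ∑ y : Fin n → Bool, 1) * ∏ j, fairMean (c j) (f j) := by
    intro x
    have e : ((2 : ℝ) ^ n)⁻¹ • ∑ y : Fin n → Bool, (1 : ℂ) = 1 := by simp
    rw [e, mean_prod_upCount, mul_one]
    by_cases hx : ∀ j, empPrefix x j = p j
    · congr 1
      refine Finset.prod_congr rfl fun j _ => ?_
      have hn' : (n : ℝ) ≠ 0 := by exact_mod_cast hn.ne'
      have : (prefixCount x j : ℝ) = c j := by
        rw [hc, ← hx j, empPrefix, div_mul_cancel₀ _ hn']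
      rw [show prefixCount x j = c j by exact_mod_cast this]
    · have : (cond P (prefixEvent X p)).real {ω | ∀ k, X k ω = x k} = 0 := by
        rw [measureReal_cond_apply hEm]
        have hdis : prefixEvent X p ∩ {ω | ∀ k, X k ω = x k} = ∅ := by
          ext ω
          simp only [Set.mem_inter_iff, Set.mem_empty_iff_false, iff_false, not_and]
          intro h hω
          have : (fun k => X k ω) = x := funext hω
          exact hx fun j => by rw [← this]; exact h j
        rw [hdis]; simp
      simp [this]
  rw [Finset.sum_congr rfl fun x _ => h x, ← Finset.sum_mul, ← hone]
  simp

end Sample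

/-! ### Factorization of the characteristic function -/

/-- The terms in `log p` cancel because `x + (1 - x) = 1`; `log 2` converts nats into bits. -/
lemma gFun_eq_cexp_fairKL {p : ℝ} (hp : 0 < p) (t x : ℝ) :
    gFun p t x = Complex.exp (Complex.I * (t * p / Real.log 2 * fairKL x : ℝ)) := by
  have key : ∀ u : ℝ, u * Real.log (p * u) = u * Real.log p + u * Real.log u := by
    intro u
    rcases eq_or_ne u 0 with rfl | hu
    · simp
    · rw [Real.log_mul hp.ne' hu]; ring
  have hl : Real.log 2 ≠ 0 := (Real.log_pos one_lt_two).ne'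
  have h : p * x * Real.logb 2 (p * x) + p * (1 - x) * Real.logb 2 (p * (1 - x))
      - p * Real.logb 2 (p / 2) = p / Real.log 2 * fairKL x := by
    simp only [Real.logb]
    rw [Real.log_div hp.ne' two_ne_zero, fairKL,
      Real.binEntropy_eq_negMulLog_add_negMulLog_one_sub]
    simp only [Real.negMulLog]
    field_simp
    linear_combination key x + key (1 - x)
  rw [gFun, h]
  congr 1
  push_cast
  ring

/-- Telescoping: `f F - g G = f (F - G) + (f - g) G`, with bounded `f` and `G`. -/
lemma isBigO_prod_sub_prod {α ι : Type*} {l : Filter α} (s : Finset ι) {f g : ι → α → ℂ}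
    {h : α → ℝ} (hf : ∀ i, f i =O[l] fun _ => (1 : ℝ)) (hg : ∀ i, g i =O[l] fun _ => (1 : ℝ))
    (hfg : ∀ i, (fun a => f i a - g i a) =O[l] h) :
    (fun a => ∏ i ∈ s, f i a - ∏ i ∈ s, g i a) =O[l] h := by
  classical
  have hp : ∀ s : Finset ι, (fun a => ∏ i ∈ s, g i a) =O[l] fun _ => (1 : ℝ) := by
    intro s
    induction s using Finset.induction_on with
    | empty => simpa using isBigO_const_const (1 : ℂ) (one_ne_zero (α := ℝ)) l
    | insert i s hi ih =>
      simp_rw [Finset.prod_insert hi]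
      simpa using (hg i).mul ih
  induction s using Finset.induction_on with
  | empty => simpa using isBigO_zero h l
  | insert i s hi ih =>
    simp_rw [Finset.prod_insert hi]
    have h1 := (hf i).mul ih
    have h2 := (hfg i).mul (hp s)
    simp only [one_mul, mul_one] at h1 h2
    refine (h1.add h2).congr_left fun a => ?_
    ring

section Sample

variable {L n : ℕ} {Ω : Type*}
  {X : Fin n → Ω → Prefix L} {Y : Fin n → Ω → Bool} {p q : Prefix L → ℝ}

lemma exists_prefixCount_of_prefixEvent_ne_zero [MeasurableSpace Ω] {P : Measure Ω}
    (hp : ∀ j, 0 < p j)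
    (hE : P (prefixEvent X p) ≠ 0) : 0 < n ∧ ∃ c : Prefix L → ℕ, ∀ j, (c j : ℝ) = p j * n := by
  obtain ⟨ω, hω⟩ := nonempty_of_measure_ne_zero hE
  have hn : 0 < n := by
    -- For `n = 0`, division by zero makes every empirical frequency `0`, against `0 < p j`.
    rcases Nat.eq_zero_or_pos n with rfl | hn
    · have := hω fun _ => true
      simp only [empPrefix, Nat.cast_zero, div_zero] at this
      exact absurd this (hp _).ne
    · exact hn
  refine ⟨hn, fun j => prefixCount (fun k => X k ω) j, fun j => ?_⟩
  have hn' : (n : ℝ) ≠ 0 := by exact_mod_cast hn.ne'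
  rw [← hω j, empPrefix, div_mul_cancel₀ _ hn']

lemma empSuffix_of_mem_prefixEvent {c : Prefix L → ℕ} (hn : 0 < n)
    (hc : ∀ j, (c j : ℝ) = p j * n) {ω : Ω} (hω : ω ∈ prefixEvent X p) (j : Prefix L) :
    empSuffix (fun k => X k ω) (fun k => Y k ω) j
      = (upCount (fun k => X k ω) (fun k => Y k ω) j : ℝ) / c j := by
  have hn' : (n : ℝ) ≠ 0 := by exact_mod_cast hn.ne'
  rw [empSuffix, hc, ← hω j, empPrefix, div_mul_cancel₀ _ hn']

lemma cexp_infoHat_of_mem_prefixEvent {ω : Ω} (hω : ω ∈ prefixEvent X p) (t : ℝ) :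
    Complex.exp (Complex.I * t * (infoHat X Y ω : ℂ))
      = ∏ j, gFun (p j) t (empSuffix (fun k => X k ω) (fun k => Y k ω) j) := by
  have h : empPrefix (fun k => X k ω) = p := funext hω
  rw [infoHat, estimator, h]
  simp only [gFun]
  rw [← Complex.exp_sum, ← Finset.mul_sum, ← Complex.ofReal_sum, Finset.sum_sub_distrib,
    marketInfo, efficientEntropy, fullEntropy, sub_neg_eq_add, neg_add_eq_sub]

variable [MeasurableSpace Ω] {P : Measure Ω}

lemma infoCharFun_eq_prod_fairMean [IsFiniteMeasure P] (hs : IsSample P X Y q)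
    (hq : ∀ j, q j = 1 / 2) (hE : P (prefixEvent X p) ≠ 0) {c : Prefix L → ℕ} (hn : 0 < n)
    (hc : ∀ j, (c j : ℝ) = p j * n) (t : ℝ) :
    infoCharFun P X Y p t = ∏ j, fairMean (c j) fun k => gFun (p j) t (k / c j) := by
  rw [infoCharFun, ← integral_cond_prod_upCount hs hq hE hn hc]
  refine integral_congr_ae ?_
  filter_upwards [ae_cond_mem (measurableSet_prefixEvent hs)] with ω hω
  rw [cexp_infoHat_of_mem_prefixEvent hω]
  exact Finset.prod_congr rfl fun j _ => by rw [empSuffix_of_mem_prefixEvent hn hc hω]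

/-- The product formula with all factors but the `j`-th equal to `1`. -/
lemma integral_gFun_empSuffix [IsFiniteMeasure P] (hs : IsSample P X Y q)
    (hq : ∀ j, q j = 1 / 2) (hE : P (prefixEvent X p) ≠ 0) {c : Prefix L → ℕ} (hn : 0 < n)
    (hc : ∀ j, (c j : ℝ) = p j * n) (t : ℝ) (j : Prefix L) :
    ∫ ω, gFun (p j) t (empSuffix (fun k => X k ω) (fun k => Y k ω) j)
        ∂(cond P (prefixEvent X p))
      = fairMean (c j) fun k => gFun (p j) t (k / c j) := by
  have h := integral_cond_prod_upCount hs hq hE hn hc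
    (Pi.mulSingle j fun k => gFun (p j) t (k / c j))
  rw [Finset.prod_eq_single j (fun i _ hij => by
    rw [Pi.mulSingle_eq_of_ne hij]; exact fairMean_const _ _) (by simp), Pi.mulSingle_eq_same] at h
  rw [← h]
  refine integral_congr_ae ?_
  filter_upwards [ae_cond_mem (measurableSet_prefixEvent hs)] with ω hω
  rw [Finset.prod_eq_single j (fun i _ hij => by
    rw [Pi.mulSingle_eq_of_ne hij]; rfl) (by simp), Pi.mulSingle_eq_same,
    empSuffix_of_mem_prefixEvent hn hc hω]

end Sample

/-! ### Comparison of the two approximations -/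

section Asymptotics

variable {N : ℕ → ℕ}

lemma tendsto_div_natCast (hN : Tendsto N atTop atTop) (z : ℂ) :
    Tendsto (fun m => z / N m) atTop (𝓝 0) := by
  have h := (tendsto_const_div_atTop_nhds_zero_nat (𝕜 := ℂ) z).comp hN
  exact h

lemma isLittleO_one_div_sq (hN : Tendsto N atTop atTop) :
    (fun m => (1 / (N m : ℝ)) ^ 2) =o[atTop] fun m => 1 / (N m : ℝ) := by
  have h : Tendsto (fun m => 1 / (N m : ℝ)) atTop (𝓝 0) :=
    tendsto_one_div_atTop_nhds_zero_nat.comp hN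
  have := ((isLittleO_one_iff ℝ).2 h).mul_isBigO (isBigO_refl (fun m => 1 / (N m : ℝ)) atTop)
  simpa [sq] using this

lemma tendsto_of_isBigO_sub_one_div_sq (hN : Tendsto N atTop atTop) {f g : ℕ → ℂ} {a : ℂ}
    (hfg : (fun m => f m - g m) =O[atTop] fun m => (1 / (N m : ℝ)) ^ 2)
    (hg : Tendsto g atTop (𝓝 a)) : Tendsto f atTop (𝓝 a) := by
  have h : Tendsto (fun m => (1 / (N m : ℝ)) ^ 2) atTop (𝓝 0) := by
    have h1 : Tendsto (fun m => 1 / (N m : ℝ)) atTop (𝓝 0) :=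
      tendsto_one_div_atTop_nhds_zero_nat.comp hN
    simpa using h1.pow 2
  have := (hfg.trans_tendsto h).add hg
  simpa using this

/-- Both `(1 + w / 2) ^ 2` and `(1 - w)⁻¹` are `1 + w + O(w ^ 2)`; the fixed power `K` preserves the
order. -/
lemma isBigO_one_add_half_pow_sub_zpow (hN : Tendsto N atTop atTop) (z : ℂ) (K : ℕ) :
    (fun m => (1 + z / N m / 2) ^ (2 * K) - (1 - z / N m) ^ (-(K : ℤ)))
      =O[atTop] fun m => (1 / (N m : ℝ)) ^ 2 := by
  have h0 := tendsto_div_natCast hN z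
  have hf : Tendsto (fun m => (1 + z / N m / 2) ^ 2) atTop (𝓝 1) := by
    simpa using ((h0.div_const 2).const_add 1).pow 2
  have hg' : Tendsto (fun m => 1 - z / N m) atTop (𝓝 1) := by simpa using h0.const_sub 1
  have hg : Tendsto (fun m => (1 - z / N m)⁻¹) atTop (𝓝 1) := by
    simpa using hg'.inv₀ one_ne_zero
  have hfg : (fun m => (1 + z / N m / 2) ^ 2 - (1 - z / N m)⁻¹)
      =O[atTop] fun m => (1 / (N m : ℝ)) ^ 2 := by
    -- The factor comes from `(1 + w / 2) ^ 2 (1 - w) - 1 = w ^ 2 (-3 / 4 - w / 4)`.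
    have hr : Tendsto (fun m => z ^ 2 * ((-3 / 4 - z / N m / 4) * (1 - z / N m)⁻¹)) atTop
        (𝓝 (z ^ 2 * ((-3 / 4 - 0 / 4) * 1))) :=
      (((h0.div_const 4).const_sub _).mul hg).const_mul _
    have hnorm : (fun m => (1 / (N m : ℂ)) ^ 2) =O[atTop] fun m => (1 / (N m : ℝ)) ^ 2 :=
      IsBigO.of_bound 1 (Eventually.of_forall fun m => by simp)
    have hr' := (hr.isBigO_one ℝ).mul hnorm
    simp only [one_mul] at hr'
    refine hr'.congr' ?_ (EventuallyEq.refl _ _)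
    filter_upwards [hg'.eventually_ne one_ne_zero] with m hm
    have e : z ^ 2 * ((-3 / 4 - z / N m / 4) * (1 - z / N m)⁻¹) * (1 / (N m : ℂ)) ^ 2
        = (z / N m) ^ 2 * (-3 / 4 - z / N m / 4) * (1 - z / N m)⁻¹ := by ring
    rw [e]
    generalize z / N m = w at hm ⊢
    field_simp
    ring
  have h := isBigO_prod_sub_prod (Finset.univ : Finset (Fin K))
    (f := fun _ m => (1 + z / N m / 2) ^ 2) (g := fun _ m => (1 - z / N m)⁻¹)
    (fun _ => hf.isBigO_one ℝ) (fun _ => hg.isBigO_one ℝ) fun _ => hfg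
  simpa [pow_mul, zpow_neg] using h

end Asymptotics

/-! ### The main theorem -/

theorem mainTheorem2 {L : ℕ} (hL : 1 ≤ L)
    -- fixed prefix probabilities, all positive, and suffix parameters under the null
    (p q : MarketInfo.Prefix L → ℝ) (hp : ∀ j, 0 < p j)
    (hnull : MarketInfo.EfficientMarket p q)
    -- samples of sizes `N m`, with `N m` tending to infinity
    (N : ℕ → ℕ) (hN : Tendsto N atTop atTop)
    {Ω : ℕ → Type*} [∀ m, MeasurableSpace (Ω m)]
    (P : (m : ℕ) → Measure (Ω m)) [∀ m, IsProbabilityMeasure (P m)]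
    (X : (m : ℕ) → Fin (N m) → Ω m → MarketInfo.Prefix L)
    (Y : (m : ℕ) → Fin (N m) → Ω m → Bool)
    (hsample : ∀ m, MarketInfo.IsSample (P m) (X m) (Y m) q)
    -- the conditioning event `n_j / n = p_j` for all `j` has positive probability
    (hE : ∀ m, P m (MarketInfo.prefixEvent (X m) p) ≠ 0) :
    -- the characteristic function factorizes
    (∀ (m : ℕ) (t : ℝ), MarketInfo.infoCharFun (P m) (X m) (Y m) p t
      = ∏ j, ∫ ω, MarketInfo.gFun (p j) t
          (MarketInfo.empSuffix (fun k => X m k ω) (fun k => Y m k ω) j)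
          ∂(cond (P m) (MarketInfo.prefixEvent (X m) p))) ∧
    -- asymptotics of the characteristic function at a fixed `t`, also to order `o(1 / n)`
    (∀ t : ℝ,
      (fun m => MarketInfo.infoCharFun (P m) (X m) (Y m) p t) ~[atTop]
        (fun m => ∏ _j : MarketInfo.Prefix L,
          (1 + Complex.I * t / (2 * Real.log 2 * N m))) ∧
      (fun m => MarketInfo.infoCharFun (P m) (X m) (Y m) p t
        - ∏ _j : MarketInfo.Prefix L, (1 + Complex.I * t / (2 * Real.log 2 * N m)))
        =o[atTop] (fun m => 1 / (N m : ℝ)) ∧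
      (fun m => MarketInfo.infoCharFun (P m) (X m) (Y m) p t) ~[atTop]
        (fun m => (1 - Complex.I * t / (Real.log 2 * N m)) ^ (-(2 ^ (L - 1) : ℤ))) ∧
      (fun m => MarketInfo.infoCharFun (P m) (X m) (Y m) p t
        - (1 - Complex.I * t / (Real.log 2 * N m)) ^ (-(2 ^ (L - 1) : ℤ)))
        =o[atTop] (fun m => 1 / (N m : ℝ))) ∧
    -- asymptotics at the scale of the fluctuations: characteristic function of `n` times the
    -- estimator
    (∀ s : ℝ, Tendsto (fun m => MarketInfo.infoCharFun (P m) (X m) (Y m) p (N m * s)) atTop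
      (𝓝 ((1 - Complex.I * s / Real.log 2) ^ (-(2 ^ (L - 1) : ℤ))))) ∧
    -- characteristic function of the gamma law of shape `2 ^ (L - 1)` and rate `n * log 2`,
    -- that is, of scale `1 / (n * log 2)`
    (∀ n : ℕ, 0 < n → ∀ t : ℝ, charFun (gammaMeasure (2 ^ (L - 1)) (n * Real.log 2)) t
      = (1 - Complex.I * t / (Real.log 2 * n)) ^ (-(2 ^ (L - 1) : ℤ))) ∧
    -- `n` times the estimator converges in distribution, conditionally on the event, to the
    -- gamma law of shape `2 ^ (L - 1)` and scale `1 / log 2`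
    (∃ (_ : ∀ m, IsProbabilityMeasure (cond (P m) (MarketInfo.prefixEvent (X m) p)))
       (_ : IsProbabilityMeasure (gammaMeasure (2 ^ (L - 1)) (Real.log 2))),
      TendstoInDistribution (fun m ω => (N m : ℝ) * MarketInfo.infoHat (X m) (Y m) ω) atTop
        (id : ℝ → ℝ) (fun m => cond (P m) (MarketInfo.prefixEvent (X m) p))
        (gammaMeasure (2 ^ (L - 1)) (Real.log 2))) := by
  have hq : ∀ j, q j = 1 / 2 := fun j => hnull j (hp j).ne'
  have hex := fun m => exists_prefixCount_of_prefixEvent_ne_zero hp (hE m)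
  have hn : ∀ m, 0 < N m := fun m => (hex m).1
  choose c hc using fun m => (hex m).2
  have hφ : ∀ m t, MarketInfo.infoCharFun (P m) (X m) (Y m) p t
      = ∏ j, fairMean (c m j) fun k =>
          Complex.exp (Complex.I * (t * p j / Real.log 2 * fairKL (k / c m j) : ℝ)) := by
    intro m t
    rw [infoCharFun_eq_prod_fairMean (hsample m) hq (hE m) (hn m) (hc m)]
    simp_rw [gFun_eq_cexp_fairKL (hp _)]
  have hl : Real.log 2 ≠ 0 := (Real.log_pos one_lt_two).ne'
  -- `1 ≤ L` lets the factors be grouped in pairs.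
  have hcard : 2 * 2 ^ (L - 1) = 2 ^ L := by rw [← pow_succ', Nat.sub_add_cancel hL]
  have hcpos : ∀ m j, 0 < c m j := fun m j => by
    have h1 : (0 : ℝ) < N m := by exact_mod_cast hn m
    have : (0 : ℝ) < c m j := by rw [hc]; exact mul_pos (hp j) h1
    exact_mod_cast this
  have hctop : ∀ j, Tendsto (fun m => c m j) atTop atTop := fun j => by
    rw [← tendsto_natCast_atTop_iff (R := ℝ)]
    simp_rw [hc]
    exact (tendsto_natCast_atTop_atTop.comp hN).const_mul_atTop (hp j)
  have hpart3 : ∀ s : ℝ, Tendsto (fun m => MarketInfo.infoCharFun (P m) (X m) (Y m) p (N m * s))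
      atTop (𝓝 ((1 - Complex.I * s / Real.log 2) ^ (-(2 ^ (L - 1) : ℤ)))) := by
    intro s
    -- At `t = N m * s` the coefficient `t * p j / log 2` is `(s / log 2) * c m j`, so the limit of
    -- each factor is free of `p j`.
    have h := tendsto_finsetProd (Finset.univ : Finset (MarketInfo.Prefix L)) fun j _ =>
      (tendsto_fairMean_cexp_mul_fairKL (s / Real.log 2)).comp (hctop j)
    have hsq := sq_integral_cexp_sq_gaussianReal (s / Real.log 2)
    rw [Finset.prod_const, Finset.card_univ,
      show Fintype.card (MarketInfo.Prefix L) = 2 * 2 ^ (L - 1) by simp [hcard], pow_mul, hsq] at h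
    have e : (1 - Complex.I * s / Real.log 2) ^ (-(2 ^ (L - 1) : ℤ))
        = (1 - Complex.I * ((s / Real.log 2 : ℝ) : ℂ))⁻¹ ^ 2 ^ (L - 1) := by
      rw [zpow_neg, inv_pow, ← zpow_natCast]
      push_cast
      rw [mul_div_assoc]
    rw [e]
    refine h.congr fun m => ?_
    rw [hφ]
    refine Finset.prod_congr rfl fun j _ => ?_
    simp only [Function.comp_apply]
    congr 1
    funext k
    congr 3
    rw [hc]
    ring
  have hpart4 : ∀ r : ℝ, 0 < r → ∀ t : ℝ, charFun (gammaMeasure (2 ^ (L - 1)) r) t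
      = (1 - Complex.I * t / r) ^ (-(2 ^ (L - 1) : ℤ)) := by
    intro r hr t
    have := charFun_gammaMeasure_natCast (k := 2 ^ (L - 1)) (by positivity) hr t
    simpa using this
  have hpi : ∀ m, IsProbabilityMeasure (cond (P m) (MarketInfo.prefixEvent (X m) p)) :=
    fun m => cond_isProbabilityMeasure (hE m)
  have hγ : IsProbabilityMeasure (gammaMeasure (2 ^ (L - 1)) (Real.log 2)) :=
    isProbabilityMeasure_gammaMeasure (by positivity) (Real.log_pos one_lt_two)
  refine ⟨fun m t => ?_, fun t => ?_, hpart3, fun n hn t => ?_, hpi, hγ, ?_⟩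
  · rw [infoCharFun_eq_prod_fairMean (hsample m) hq (hE m) (hn m) (hc m)]
    exact Finset.prod_congr rfl fun j _ =>
      (integral_gFun_empSuffix (hsample m) hq (hE m) (hn m) (hc m) t j).symm
  · set z : ℂ := Complex.I * t / Real.log 2 with hz
    have e1 : ∀ m, (1 + Complex.I * t / (2 * Real.log 2 * N m) : ℂ) = 1 + z / N m / 2 := by
      intro m; rw [hz]; ring
    have e2 : ∀ m, (1 - Complex.I * t / (Real.log 2 * N m) : ℂ) = 1 - z / N m := by
      intro m; rw [hz]; ring
    simp_rw [e1, e2]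
    have hlim : Tendsto (fun m => 1 + z / N m / 2) atTop (𝓝 1) := by
      simpa using ((tendsto_div_natCast hN z).div_const 2).const_add 1
    have hO : ∀ j, (fun m => fairMean (c m j) (fun k =>
          Complex.exp (Complex.I * (t * p j / Real.log 2 * fairKL (k / c m j) : ℝ)))
        - (1 + z / N m / 2)) =O[atTop] fun m => (1 / (N m : ℝ)) ^ 2 := by
      intro j
      refine IsBigO.of_bound ((9 * (t * p j / Real.log 2) ^ 2 + |t * p j / Real.log 2|)
        / p j ^ 2) (Eventually.of_forall fun m => ?_)
      have h := norm_fairMean_cexp_fairKL_sub_le (hcpos m j) (t * p j / Real.log 2)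
      -- `c m j = p j * N m` cancels `p j`: all factors have the same first-order term.
      have e3 : Complex.I * ((t * p j / Real.log 2 : ℝ) : ℂ) / (2 * (c m j : ℂ))
          = z / N m / 2 := by
        have hpj : (p j : ℂ) ≠ 0 := by exact_mod_cast (hp j).ne'
        have hNm : (N m : ℂ) ≠ 0 := by exact_mod_cast (hn m).ne'
        have hcm : (c m j : ℂ) = p j * N m := by exact_mod_cast congrArg Complex.ofReal (hc m j)
        rw [hcm, hz]
        push_cast
        field_simp
      rw [e3] at h
      refine h.trans_eq ?_
      rw [hc, Real.norm_of_nonneg (by positivity)]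
      ring
    have hO1 : (fun m => MarketInfo.infoCharFun (P m) (X m) (Y m) p t
        - ∏ _j : MarketInfo.Prefix L, (1 + z / N m / 2))
        =O[atTop] fun m => (1 / (N m : ℝ)) ^ 2 := by
      simp_rw [hφ]
      exact isBigO_prod_sub_prod Finset.univ
        (fun j => (tendsto_of_isBigO_sub_one_div_sq hN (hO j) hlim).isBigO_one ℝ)
        (fun _ => hlim.isBigO_one ℝ) hO
    have hO2 : (fun m => MarketInfo.infoCharFun (P m) (X m) (Y m) p t
        - (1 - z / N m) ^ (-(2 ^ (L - 1) : ℤ)))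
        =O[atTop] fun m => (1 / (N m : ℝ)) ^ 2 := by
      refine (hO1.add (isBigO_one_add_half_pow_sub_zpow hN z (2 ^ (L - 1)))).congr_left
        fun m => ?_
      rw [Finset.prod_const, Finset.card_univ,
        show Fintype.card (MarketInfo.Prefix L) = 2 * 2 ^ (L - 1) by simp [hcard]]
      push_cast
      ring
    have hl1 : Tendsto (fun m => ∏ _j : MarketInfo.Prefix L, (1 + z / N m / 2)) atTop (𝓝 1) := by
      simpa using tendsto_finsetProd (Finset.univ : Finset (MarketInfo.Prefix L))
        fun _ _ => hlim
    have hl2 : Tendsto (fun m => (1 - z / N m) ^ (-(2 ^ (L - 1) : ℤ))) atTop (𝓝 1) := by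
      have h := ((tendsto_div_natCast hN z).const_sub 1).zpow₀ (-(2 ^ (L - 1) : ℤ))
        (Or.inl (by simp))
      simpa using h
    have hlφ := tendsto_of_isBigO_sub_one_div_sq hN hO1 hl1
    -- At fixed `t` everything tends to `1`, which already gives the equivalences; the first-order
    -- information is in `hO1` and `hO2`.
    have heq : ∀ {g : ℕ → ℂ}, Tendsto g atTop (𝓝 1) →
        (fun m => MarketInfo.infoCharFun (P m) (X m) (Y m) p t) ~[atTop] g := fun hg =>
      ((isEquivalent_const_iff_tendsto one_ne_zero).2 hlφ).trans
        ((isEquivalent_const_iff_tendsto one_ne_zero).2 hg).symm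
    exact ⟨heq hl1, hO1.trans_isLittleO (isLittleO_one_div_sq hN), heq hl2,
      hO2.trans_isLittleO (isLittleO_one_div_sq hN)⟩
  · rw [hpart4 _ (mul_pos (by exact_mod_cast hn) (Real.log_pos one_lt_two))]
    push_cast
    rw [mul_comm (n : ℂ)]
  · have hmeas : ∀ m, Measurable fun ω => (N m : ℝ) * MarketInfo.infoHat (X m) (Y m) ω :=
      fun m => (measurable_infoHat (hsample m)).const_mul _
    refine ⟨fun m => (hmeas m).aemeasurable, aemeasurable_id, ?_⟩
    -- Lévy's continuity theorem: the characteristic function of `N m` times the estimator at `s` is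
    -- that of the estimator at `N m * s`.
    refine ProbabilityMeasure.tendsto_iff_tendsto_charFun.2 fun s => ?_
    simp only [ProbabilityMeasure.coe_mk, Measure.map_id]
    rw [hpart4 _ (Real.log_pos one_lt_two)]
    refine (hpart3 s).congr fun m => ?_
    rw [charFun_apply_real, integral_map (hmeas m).aemeasurable
      (Continuous.aestronglyMeasurable (by fun_prop)), MarketInfo.infoCharFun]
    congr 1
    funext ω
    congr 1
    push_cast
    ring
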